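/- Theorem (sum-threshold functions over non-binary alphabets on trees). Let $T=(V,E)$ be a finite tree in which node $i\in V$ holds measurements $X_i\in\{0,1,\dots,l_i\}$, where $l_i\ge 0$ is an integer. For $A\subseteq V$ put $l_A:=\sum_{i\in A}l_i$, let $\theta$ be an integer with $0\le\theta\le l_V+1$, and let $\Pi_\theta(X)=1$ if $\sum_{i\in V}X_i\ge\theta$ and $\Pi_\theta(X)=0$ otherwise. For a block length $B$, each node $i$ holds a block $X_i^B$ of $B$ measurements. A strategy $S_B$ is a deterministic interactive protocol with finitely many time slots. In each slot, on each edge, either one of the two endpoints transmits one bit or neither does; which of these happens is determined by the previous transmissions on that edge; and a bit transmitted by node $i$ is a function of $X_i^B$ and of all previous transmissions sent or heard by $i$. Let $\mathcal S_B$ be the set of strategies such that, for every input, each node $i$ determines without error the values of $\Pi_\theta$ at all $B$ instances from $X_i^B$ and the transmissions it sent and heard. For an edge $e$, let $C_e(\Pi_\theta,S_B,B)$ be the worst case, over all inputs, of the total number of bits exchanged along $e$ (in both directions), and let $$C_e(\Pi_\theta):=\lim_{B\to\infty}\ \min_{S_B\in\mathcal S_B}\frac{C_e(\Pi_\theta,S_B,B)}{B}.$$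 Let $e\in E$, and let $A_e$ and $V\setminus A_e$ be the vertex sets of the two components into which the removal of $e$ disconnects $T$. Then the minima and the limit exist, and $$C_e(\Pi_\theta)=\log_2\min\bigl\{\,2\theta+1,\ 2\min(l_{A_e},l_{V\setminus A_e})+2,\ 2(l_V-\theta+1)+1\,\bigr\}.$$ -/

import Mathlib

namespace TreeComputation

/-- A joint block of `B` measurements: at each instance `b < B`, node `v` measures a value in
`{0, 1, ..., l v}`. -/
abbrev BlockInput {V : Type*} (l : V → ℕ) (B : ℕ) : Type _ :=
  (v : V) → Fin B → Fin (l v + 1)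

/-- What has happened on one edge so far, most recent time slot first: `some b` means that the bit
`b` was transmitted in the slot, `none` that nobody transmitted. -/
abbrev EdgeHistory : Type := List (Option Bool)

/-- What a node knows about the previous transmissions: the histories of its incident edges (what
it has sent and what it has heard). -/
abbrev LocalView {V : Type*} (G : SimpleGraph V) (v : V) : Type _ :=
  G.incidenceSet v → EdgeHistory

/-- A deterministic interactive strategy for blocks of length `B` on the network `G`. Time is
divided into slots. In each slot, on each edge, one endpoint transmits one bit, or neither does
(a longer message takes several slots). -/
structure Strategy {V : Type*} (G : SimpleGraph V) (l : V → ℕ) (B : ℕ) where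
  /-- the number of time slots -/
  rounds : ℕ
  /-- Which endpoint of the edge transmits in the next slot, if any. This is determined by the
  previous transmissions on the edge, so that both endpoints know it, and silence or the direction
  of a transmission carries no information. -/
  turn : (e : G.edgeSet) → EdgeHistory → Option {v : V // v ∈ (e : Sym2 V)}
  /-- The bit that node `v` transmits on an incident edge when it is its turn, as a function of
  its own measurement block and of all previous transmissions that `v` sent or heard. -/
  send : (v : V) → G.incidenceSet v → (Fin B → Fin (l v + 1)) → LocalView G v → Bool
  /-- The block of function values that node `v` decodes at the end. -/
  output : (v : V) → (Fin B → Fin (l v + 1)) → LocalView G v → (Fin B → Bool)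

namespace Strategy

variable {V : Type*} {G : SimpleGraph V} {l : V → ℕ} {B : ℕ}

/-- The history of every edge after the first `t` time slots, on the input `x`. -/
def history (S : Strategy G l B) (x : BlockInput l B) : ℕ → G.edgeSet → EdgeHistory
  | 0, _ => []
  | t + 1, e =>
      (S.turn e (S.history x t e)).map (fun v =>
        S.send v.1 ⟨e.1, e.2, v.2⟩ (x v.1) (fun e' => S.history x t ⟨e'.1, e'.2.1⟩))
      :: S.history x t e

/-- The local view of node `v` at the end of the run on `x`. -/
def finalView (S : Strategy G l B) (x : BlockInput l B) (v : V) : LocalView G v :=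
  fun e => S.history x S.rounds ⟨e.1, e.2.1⟩

/-- Zero-error block computation of `f` at all nodes: on every input, every node decodes the value
of `f` at each of the `B` instances. -/
def Computes (S : Strategy G l B) (f : ((v : V) → Fin (l v + 1)) → Bool) : Prop :=
  ∀ (x : BlockInput l B) (v : V),
    S.output v (x v) (S.finalView x v) = fun b => f (fun u => x u b)

/-- The number of bits exchanged (in both directions together) along the edge `e` on `x`. -/
def bitsOn (S : Strategy G l B) (x : BlockInput l B) (e : G.edgeSet) : ℕ :=
  (S.history x S.rounds e).countP Option.isSome

/-- The worst-case number of bits exchanged along the edge `e`. -/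
def worstCaseBits [Fintype V] [DecidableEq V] (S : Strategy G l B) (e : G.edgeSet) : ℕ :=
  Finset.univ.sup (fun x : BlockInput l B => S.bitsOn x e)

end Strategy

/-- The worst-case numbers of bits along `e` of the strategies that compute `f` without error at
all nodes, for blocks of length `B`. -/
def edgeCosts {V : Type*} [Fintype V] [DecidableEq V] (G : SimpleGraph V) (l : V → ℕ)
    (f : ((v : V) → Fin (l v + 1)) → Bool) (e : G.edgeSet) (B : ℕ) : Set ℕ :=
  {c | ∃ S : Strategy G l B, S.Computes f ∧ S.worstCaseBits e = c}

/-- `C` is the worst-case per-instance complexity of computing `f` on the edge `e`: for every block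
length the minimal cost on `e` exists, and these minima, divided by the block length, tend to `C`. -/
def HasEdgeComplexity {V : Type*} [Fintype V] [DecidableEq V] (G : SimpleGraph V) (l : V → ℕ)
    (f : ((v : V) → Fin (l v + 1)) → Bool) (e : G.edgeSet) (C : ℝ) : Prop :=
  ∃ c : ℕ → ℕ, (∀ B, IsLeast (edgeCosts G l f e B) (c B)) ∧
    Filter.Tendsto (fun B : ℕ => (c B : ℝ) / (B : ℝ)) Filter.atTop (nhds C)

/-- The sum-threshold function with threshold `θ`. -/
def sumThreshold {V : Type*} [Fintype V] (l : V → ℕ) (θ : ℕ) (x : (v : V) → Fin (l v + 1)) :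
    Bool :=
  decide (θ ≤ ∑ v, (x v : ℕ))

open Classical in
/-- The vertices of the component containing `i` after removal of the edge `s(i, j)`. -/
noncomputable def edgeSide {V : Type*} [Fintype V] (G : SimpleGraph V) (i j : V) : Finset V :=
  Finset.univ.filter (fun v => (G.deleteEdges {s(i, j)}).Reachable i v)

/-- The largest possible total measurement `∑ i ∈ A, l i` of the nodes in `A`. -/
def totalSize {V : Type*} (l : V → ℕ) (A : Finset V) : ℕ := ∑ v ∈ A, l v

end TreeComputation

/-! Let `N` be the minimum inside the logarithm. For blocks of length `B` the least cost on the edge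
is exactly `Nat.clog 2 (N ^ B)`, and the limit follows.

Lower bound: inputs with the same transcript on the edge can be mixed across it without any node
noticing, so they have the same function values (`Computes.apply_piecewise`). Some `N` pairs of side
sums, with totals alternating between `θ` and `θ - 1`, form a fooling set (`exists_fooling_pairs`).
Its `B`-th power forces `N ^ B` distinct transcripts, which are prefix-free as bit strings and hence
need `clog` bits.

Upper bound: per instance, one end has a message summarizing its side, and the other end owes an
answer bit only if the message leaves the value open. A block of messages with `r` open instances
receives a dyadic interval of `2 ^ r` numbers. The lengths add up to `N ^ B`, so the intervals fit
below `2 ^ L` as soon as `N ^ B ≤ 2 ^ L` (`exists_dyadic_intervals`). The ends spell out one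
`L`-digit number: the leading digits select the interval, the remaining ones give the answers
(`exists_transmit`). Gathering inputs and spreading values within a side costs nothing on this edge
(`exists_flood`). -/

namespace TreeComputation

/-! ### Extending strategies and spreading knowledge within a side -/

namespace Strategy

variable {V : Type*} {G : SimpleGraph V} {l : V → ℕ} {B : ℕ}

/-- The history of an edge at the end of the run on `x`. -/
def finalHistory (S : Strategy G l B) (x : BlockInput l B) (e : G.edgeSet) : EdgeHistory :=
  S.history x S.rounds e

theorem length_history (S : Strategy G l B) (x : BlockInput l B) (t : ℕ) (e : G.edgeSet) :
    (S.history x t e).length = t := by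
  induction t with
  | zero => simp [history]
  | succ t ih => simp [history, ih]

theorem finalView_apply (S : Strategy G l B) (x : BlockInput l B) (v : V)
    (e : G.incidenceSet v) : S.finalView x v e = S.finalHistory x ⟨e.1, e.2.1⟩ := rfl

theorem finalHistory_eq_of_finalView_eq {S : Strategy G l B} {x x' : BlockInput l B} {v : V}
    (h : S.finalView x v = S.finalView x' v) (e : G.edgeSet) (hv : v ∈ (e : Sym2 V)) :
    S.finalHistory x e = S.finalHistory x' e :=
  congrFun h ⟨e.1, e.2, hv⟩

theorem bitsOn_eq_length_reduceOption (S : Strategy G l B) (x : BlockInput l B) (e : G.edgeSet) :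
    S.bitsOn x e = (S.finalHistory x e).reduceOption.length := by
  rw [List.reduceOption_length_eq, bitsOn, finalHistory, List.countP_eq_length_filter]

open Classical in
/-- A strategy can be prolonged by one slot in which one bit is sent on the edge `ε`. The sender is
determined by the history of the edge, and must be able to compute the bit. -/
theorem exists_extend (S : Strategy G l B) (ε : G.edgeSet)
    (τ : EdgeHistory → {v : V // v ∈ (ε : Sym2 V)}) (φ : BlockInput l B → Bool)
    (h : ∀ x x' v, (τ (S.finalHistory x ε)).1 = v → x v = x' v →
      S.finalView x v = S.finalView x' v → φ x = φ x') :
    ∃ S' : Strategy G l B, ∀ x e, S'.finalHistory x e =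
      (if e = ε then some (φ x) else none) :: S.finalHistory x e := by
  let S' : Strategy G l B :=
    { rounds := S.rounds + 1
      turn := fun e h =>
        -- Silent slots are recorded too, so the length of a history is the current time.
        if h.length < S.rounds then S.turn e h
        else if he : e = ε then some ⟨(τ h).1, he ▸ (τ h).2⟩ else none
      send := fun v e xv view =>
        if (view e).length < S.rounds then S.send v e xv view
        -- The sender sees only local data; `h` makes all inputs compatible with them agree on the
        -- bit.
        else decide (∃ x, x v = xv ∧ S.finalView x v = view ∧
          (τ (S.finalHistory x ε)).1 = v ∧ φ x = true)
      output := S.output }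
  have key : ∀ x t, t ≤ S.rounds → S'.history x t = S.history x t := by
    intro x t
    induction t with
    | zero => intro _; rfl
    | succ t ih =>
      intro ht
      have ih := ih (by omega)
      funext e
      have ht' : t < S.rounds := ht
      simp [history, ih, S', length_history, ht']
  refine ⟨S', fun x e => ?_⟩
  have hT := key x S.rounds le_rfl
  have hview : ∀ v : V, (fun e' : G.incidenceSet v => S.history x S.rounds ⟨e'.1, e'.2.1⟩) =
    S.finalView x v := fun _ => rfl
  change S'.history x (S.rounds + 1) e = _
  rw [history, hT]
  congr 1
  by_cases he : e = ε
  · subst he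
    simp only [S', length_history, lt_irrefl, if_false, dite_true, if_true, Option.map_some,
      hview]
    congr 1
    by_cases hφ : φ x = true
    · rw [hφ, decide_eq_true_iff]
      exact ⟨x, rfl, rfl, rfl, hφ⟩
    · rw [Bool.not_eq_true] at hφ
      rw [hφ, decide_eq_false_iff_not]
      rintro ⟨x', h1, h2, h3, h4⟩
      rw [h x' x _ h3 h1 h2, hφ] at h4
      exact Bool.noConfusion h4
  · simp [S', length_history, he]

/-- Under `S`, the node `v` can compute `φ` from its own measurements and its transcript. -/
def Knows {β : Type*} (S : Strategy G l B) (v : V) (φ : BlockInput l B → β) : Prop :=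
  ∀ x x', x v = x' v → S.finalView x v = S.finalView x' v → φ x = φ x'

/-- The transcripts of `S'` determine those of `S`, at every node. -/
def Refines (S' S : Strategy G l B) : Prop :=
  ∀ x x' v, S'.finalView x v = S'.finalView x' v → S.finalView x v = S.finalView x' v

theorem Refines.trans {S₁ S₂ S₃ : Strategy G l B} (h : S₁.Refines S₂) (h' : S₂.Refines S₃) :
    S₁.Refines S₃ := fun x x' v hv => h' x x' v (h x x' v hv)

theorem Knows.mono {β : Type*} {S S' : Strategy G l B} {v : V} {φ : BlockInput l B → β}
    (h : S.Knows v φ) (hr : S'.Refines S) : S'.Knows v φ :=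
  fun x x' hx hv => h x x' hx (hr x x' v hv)

theorem refines_of_finalHistory_eq_cons {S S' : Strategy G l B}
    (a : BlockInput l B → G.edgeSet → Option Bool)
    (h : ∀ x e, S'.finalHistory x e = a x e :: S.finalHistory x e) : S'.Refines S := by
  intro x x' v hv
  funext e
  have h1 := congrFun hv e
  rw [finalView_apply, finalView_apply, h, h] at h1
  exact (List.cons.inj h1).2

/-- `S'` refines `S` without further bits on the edge `e`. -/
def QuietlyRefines (e : G.edgeSet) (S' S : Strategy G l B) : Prop :=
  S'.Refines S ∧
    ∀ x, (S'.finalHistory x e).reduceOption = (S.finalHistory x e).reduceOption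

theorem QuietlyRefines.refl (e : G.edgeSet) (S : Strategy G l B) : QuietlyRefines e S S :=
  ⟨fun _ _ _ h => h, fun _ => rfl⟩

theorem QuietlyRefines.trans {e : G.edgeSet} {S₁ S₂ S₃ : Strategy G l B}
    (h : QuietlyRefines e S₁ S₂) (h' : QuietlyRefines e S₂ S₃) : QuietlyRefines e S₁ S₃ :=
  ⟨h.1.trans h'.1, fun x => (h.2 x).trans (h'.2 x)⟩

/-- A node can tell a neighbour a bit that it knows. -/
theorem exists_knows_of_mem {e ε : G.edgeSet} (hε : ε ≠ e) {u v : V} (hu : u ∈ (ε : Sym2 V))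
    (hv : v ∈ (ε : Sym2 V)) {S : Strategy G l B} {φ : BlockInput l B → Bool}
    (h : S.Knows u φ) : ∃ S', QuietlyRefines e S' S ∧ S'.Knows v φ := by
  classical
  obtain ⟨S', hS'⟩ := S.exists_extend ε (fun _ => ⟨u, hu⟩) φ (by
    rintro x x' _ rfl h1 h2; exact h x x' h1 h2)
  refine ⟨S', ⟨refines_of_finalHistory_eq_cons _ hS', fun x => ?_⟩, fun x x' _ h2 => ?_⟩
  · rw [hS', if_neg hε.symm, List.reduceOption_cons_of_none]
  · have := finalHistory_eq_of_finalView_eq h2 ε hv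
    rw [hS', hS', if_pos rfl, if_pos rfl] at this
    exact Option.some.inj (List.cons.inj this).1

theorem exists_knows_of_reachable {e : G.edgeSet} {u v : V}
    (huv : (G.deleteEdges {(e : Sym2 V)}).Reachable u v) {S : Strategy G l B}
    {φ : BlockInput l B → Bool} (h : S.Knows u φ) :
    ∃ S', QuietlyRefines e S' S ∧ S'.Knows v φ := by
  rw [SimpleGraph.reachable_iff_reflTransGen] at huv
  induction huv with
  | refl => exact ⟨S, .refl e S, h⟩
  | @tail b c _ hbc ih =>
    obtain ⟨S₁, h1, h2⟩ := ih
    rw [SimpleGraph.deleteEdges_adj] at hbc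
    obtain ⟨S₂, h3, h4⟩ := exists_knows_of_mem (e := e) (ε := ⟨s(b, c), hbc.1⟩)
      (fun h => hbc.2 (by rw [← h]; rfl)) (Sym2.mem_mk_left b c) (Sym2.mem_mk_right b c) h2
    exact ⟨S₂, h3.trans h1, h4⟩

/-- Without using the edge `e`, all nodes can share what they know with all nodes on the same side
of `e`. -/
theorem exists_flood [Finite V] (e : G.edgeSet) (S : Strategy G l B) :
    ∃ S', QuietlyRefines e S' S ∧ ∀ u v, (G.deleteEdges {(e : Sym2 V)}).Reachable u v →
      ∀ φ : BlockInput l B → Bool, S.Knows u φ → S'.Knows v φ := by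
  classical
  have := Fintype.ofFinite V
  -- There are finitely many nodes and Boolean functions of the input, so the triples can be served
  -- one by one; later slots never destroy knowledge.
  suffices H : ∀ Q : Finset (V × V × (BlockInput l B → Bool)),
      ∃ S', QuietlyRefines e S' S ∧ ∀ q ∈ Q, (G.deleteEdges {(e : Sym2 V)}).Reachable q.1 q.2.1 →
        S.Knows q.1 q.2.2 → S'.Knows q.2.1 q.2.2 by
    obtain ⟨S', h1, h2⟩ := H Finset.univ
    exact ⟨S', h1, fun u v huv φ hφ => h2 (u, v, φ) (Finset.mem_univ _) huv hφ⟩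
  intro Q
  induction Q using Finset.induction_on with
  | empty => exact ⟨S, .refl e S, by simp⟩
  | insert q Q _ ih =>
    obtain ⟨S₁, h1, h2⟩ := ih
    by_cases hq : (G.deleteEdges {(e : Sym2 V)}).Reachable q.1 q.2.1 ∧ S.Knows q.1 q.2.2
    · obtain ⟨S₂, h3, h4⟩ := exists_knows_of_reachable hq.1 (hq.2.mono h1.1)
      refine ⟨S₂, h3.trans h1, fun q' hq' hr hk => ?_⟩
      rcases Finset.mem_insert.1 hq' with rfl | hq'
      · exact h4
      · exact (h2 q' hq' hr hk).mono h3.1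
    · refine ⟨S₁, h1, fun q' hq' hr hk => ?_⟩
      rcases Finset.mem_insert.1 hq' with rfl | hq'
      · exact absurd ⟨hr, hk⟩ hq
      · exact h2 q' hq' hr hk

/-- If all nodes know the values of `f`, they can output them. -/
theorem exists_computes {S : Strategy G l B} {f : ((v : V) → Fin (l v + 1)) → Bool}
    (h : ∀ v b, S.Knows v (fun x => f (fun u => x u b))) :
    ∃ S' : Strategy G l B, S'.Computes f ∧ ∀ x e, S'.bitsOn x e = S.bitsOn x e := by
  classical
  let S' : Strategy G l B :=
    { S with
      output := fun v xv view b =>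
        decide (∃ x, x v = xv ∧ S.finalView x v = view ∧ f (fun u => x u b) = true) }
  have hist : ∀ x t, S'.history x t = S.history x t := by
    intro x t
    induction t with
    | zero => rfl
    | succ t ih => funext e; simp [history, ih, S']
  have hview : ∀ x v, S'.finalView x v = S.finalView x v := by
    intro x v
    funext e
    simp only [finalView, hist]
    rfl
  refine ⟨S', fun x v => ?_, fun x e => ?_⟩
  · funext b
    rw [hview]
    by_cases hf : f (fun u => x u b) = true
    · rw [hf]
      exact decide_eq_true ⟨x, rfl, rfl, hf⟩
    · refine (decide_eq_false ?_).trans (Bool.not_eq_true _ ▸ hf).symm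
      rintro ⟨x', h1, h2, h3⟩
      exact hf ((h v b x' x h1 h2).symm.trans h3)
  · simp only [bitsOn, hist]
    rfl

/-- The trivial strategy, without any transmission. -/
def silent (G : SimpleGraph V) (l : V → ℕ) (B : ℕ) : Strategy G l B where
  rounds := 0
  turn _ _ := none
  send _ _ _ _ := false
  output _ _ _ _ := false

theorem reduceOption_finalHistory_silent (x : BlockInput l B) (e : G.edgeSet) :
    ((silent G l B).finalHistory x e).reduceOption = [] := rfl

/-! ### Joint transmission of a number and dyadic intervals -/

/-- The number with the binary digits `h`, the least significant first. -/
abbrev bitsValue (h : List Bool) : ℕ := Nat.ofDigits 2 (h.map Bool.toNat)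

/-- The two ends `p`, `q` of an edge transmit the `L` binary digits of a number `n`, the leading
ones first. The values of `n` compatible with the message `μ` of `p` form a dyadic interval; once
the digits already sent determine this interval, `q` takes over. -/
theorem exists_transmit {α : Type*} {S : Strategy G l B} {e : G.edgeSet} {p q : V}
    (hp : p ∈ (e : Sym2 V)) (hq : q ∈ (e : Sym2 V))
    (hS : ∀ x, (S.finalHistory x e).reduceOption = [])
    (k d : α → ℕ) (hd : ∀ m a a', m / 2 ^ k a = d a → m / 2 ^ k a' = d a' → a = a')
    (μ : BlockInput l B → α) (n : BlockInput l B → ℕ) (hn : ∀ x, n x / 2 ^ k (μ x) = d (μ x))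
    (L : ℕ) (hL : ∀ x, n x < 2 ^ L) (hpμ : S.Knows p μ)
    (hqn : ∀ x x', x q = x' q → S.finalView x q = S.finalView x' q → μ x = μ x' → n x = n x') :
    ∀ t ρ, t + ρ = L → ∃ S' : Strategy G l B, S'.Refines S ∧
      ∀ x, (S'.finalHistory x e).reduceOption.length = t ∧
        bitsValue (S'.finalHistory x e).reduceOption = n x / 2 ^ ρ := by
  classical
  intro t
  induction t with
  | zero =>
    intro ρ hρ
    refine ⟨S, fun _ _ _ h => h, fun x => ?_⟩
    have : n x / 2 ^ ρ = 0 := Nat.div_eq_of_lt (by rw [← hρ, zero_add] at hL; exact hL x)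
    simp [hS, this, bitsValue]
  | succ t ih =>
    intro ρ hρ
    obtain ⟨S₁, hr, h1⟩ := ih (ρ + 1) (by omega)
    -- All continuations of the digits sent so far lie in one of the intervals. Only the history of
    -- the edge enters, so it may decide the turn.
    let own : EdgeHistory → Prop := fun h =>
      ∃ a, ρ + 1 ≤ k a ∧ bitsValue h.reduceOption / 2 ^ (k a - (ρ + 1)) = d a
    have hown : ∀ x a, ρ + 1 ≤ k a →
        bitsValue (S₁.finalHistory x e).reduceOption / 2 ^ (k a - (ρ + 1)) = n x / 2 ^ k a := by
      intro x a ha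
      rw [(h1 x).2, Nat.div_div_eq_div_mul, ← pow_add, Nat.add_sub_cancel' ha]
    obtain ⟨S₂, h2⟩ := S₁.exists_extend e
      (fun h => if own h then ⟨q, hq⟩ else ⟨p, hp⟩) (fun x => decide (n x / 2 ^ ρ % 2 = 1)) (by
        intro x x' v hv hx hview
        suffices n x / 2 ^ ρ = n x' / 2 ^ ρ by simp only [this]
        by_cases ho : own (S₁.finalHistory x e)
        · rw [if_pos ho] at hv
          subst hv
          have hh := finalHistory_eq_of_finalView_eq hview e hq
          obtain ⟨a, ha, hda⟩ := ho
          have hx1 := hda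
          have hx2 := hda
          rw [hown x a ha] at hx1
          rw [hh, hown x' a ha] at hx2
          -- Disjointness makes `a` the message of both inputs, and with it `q` computes the whole
          -- number.
          rw [hqn x x' hx (hr x x' _ hview)
            ((hd _ _ _ (hn x) hx1).trans (hd _ _ _ (hn x') hx2).symm)]
        · rw [if_neg ho] at hv
          subst hv
          have hμ := hpμ x x' hx (hr x x' _ hview)
          -- Otherwise the interval of `μ x` would already be determined. Hence the next digit of `n
          -- x` is a digit of `d (μ x)`, known to `p`.
          have hk : k (μ x) ≤ ρ := by
            by_contra hk
            exact ho ⟨μ x, by omega, by rw [hown x _ (by omega), hn]⟩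
          have e1 := hn x
          have e2 := hn x'
          rw [← hμ] at e2
          rw [← Nat.add_sub_cancel' hk, pow_add, ← Nat.div_div_eq_div_mul,
            ← Nat.div_div_eq_div_mul, e1, e2])
    refine ⟨S₂, (refines_of_finalHistory_eq_cons _ h2).trans hr, fun x => ?_⟩
    rw [h2, if_pos rfl, List.reduceOption_cons_of_some]
    refine ⟨by simp [(h1 x).1], ?_⟩
    -- The newest bit is the head of the list and the least significant digit: appending it doubles
    -- the old value.
    rw [bitsValue, List.map_cons, Nat.ofDigits_cons, ← bitsValue, (h1 x).2, pow_succ,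
      ← Nat.div_div_eq_div_mul]
    have := Nat.mod_two_eq_zero_or_one (n x / 2 ^ ρ)
    have h3 : (decide (n x / 2 ^ ρ % 2 = 1)).toNat = n x / 2 ^ ρ % 2 := by
      rcases this with h | h <;> simp [h]
    rw [h3]
    have := Nat.mod_add_div (n x / 2 ^ ρ) 2
    simpa using this

end Strategy

/-- Disjoint dyadic intervals of lengths `2 ^ k a` fit into an interval of length `2 ^ L` if the
sum of their lengths is at most `2 ^ L`. The interval of `a` consists of the `m` with
`m / 2 ^ k a = d a`. -/
theorem exists_dyadic_intervals {α : Type*} [Fintype α] (k : α → ℕ) {L : ℕ}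
    (hL : ∑ a, 2 ^ k a ≤ 2 ^ L) :
    ∃ d : α → ℕ, (∀ a, 2 ^ k a * d a + 2 ^ k a ≤ 2 ^ L) ∧
      ∀ m a a', m / 2 ^ k a = d a → m / 2 ^ k a' = d a' → a = a' := by
  classical
  suffices H : ∀ s : Finset α, ∃ d : α → ℕ,
      (∀ a ∈ s, 2 ^ k a * d a + 2 ^ k a ≤ ∑ a ∈ s, 2 ^ k a) ∧
      ∀ m, ∀ a ∈ s, ∀ a' ∈ s, m / 2 ^ k a = d a → m / 2 ^ k a' = d a' → a = a' by
    obtain ⟨d, h1, h2⟩ := H Finset.univ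
    exact ⟨d, fun a => (h1 a (Finset.mem_univ a)).trans hL,
      fun m a a' => h2 m a (Finset.mem_univ a) a' (Finset.mem_univ a')⟩
  intro s
  -- Longest intervals are placed first: the length of a new one divides the total length so far, so
  -- it can start right there.
  induction s using Finset.induction_on_min_value k with
  | empty => exact ⟨0, by simp, by simp⟩
  | insert a s ha hmin ih =>
    obtain ⟨d, h1, h2⟩ := ih
    have hdvd : 2 ^ k a ∣ ∑ a ∈ s, 2 ^ k a :=
      Finset.dvd_sum fun b hb => pow_dvd_pow 2 (hmin b hb)
    have hda : 2 ^ k a * ((∑ a ∈ s, 2 ^ k a) / 2 ^ k a) = ∑ a ∈ s, 2 ^ k a :=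
      Nat.mul_div_cancel' hdvd
    have hne : ∀ b ∈ s, b ≠ a := fun b hb h => ha (h ▸ hb)
    have hlt : ∀ m, ∀ b ∈ s, m / 2 ^ k b = d b →
        m / 2 ^ k a = (∑ a ∈ s, 2 ^ k a) / 2 ^ k a → False := by
      intro m b hb hmb hma
      have e1 := Nat.mod_add_div m (2 ^ k b)
      have e2 := Nat.mod_lt m (pow_pos two_pos (k b) : 2 ^ k b > 0)
      have e3 := Nat.mul_div_le m (2 ^ k a)
      rw [hma, hda] at e3
      rw [hmb] at e1
      have := h1 b hb
      omega
    refine ⟨Function.update d a ((∑ a ∈ s, 2 ^ k a) / 2 ^ k a), ?_, ?_⟩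
    · intro b hb
      rw [Finset.sum_insert ha]
      rcases Finset.mem_insert.1 hb with rfl | hb
      · rw [Function.update_self, hda, add_comm]
      · rw [Function.update_of_ne (hne b hb)]
        exact (h1 b hb).trans (Nat.le_add_left _ _)
    · intro m b hb b' hb' hm hm'
      rcases Finset.mem_insert.1 hb with rfl | hbs <;> rcases Finset.mem_insert.1 hb' with rfl | hbs'
      · rfl
      · rw [Function.update_self] at hm
        rw [Function.update_of_ne (hne b' hbs')] at hm'
        exact (hlt m b' hbs' hm' hm).elim
      · rw [Function.update_self] at hm'
        rw [Function.update_of_ne (hne b hbs)] at hm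
        exact (hlt m b hbs hm hm').elim
      · rw [Function.update_of_ne (hne b hbs)] at hm
        rw [Function.update_of_ne (hne b' hbs')] at hm'
        exact h2 m b hbs b' hbs' hm hm'

/-! ### Cuts and the general protocol -/

/-- `A` and its complement are the two sides of the edge `s(p, q)`. -/
structure IsCut {V : Type*} (G : SimpleGraph V) (p q : V) (A : Finset V) : Prop where
  adj : G.Adj p q
  left_mem : p ∈ A
  right_notMem : q ∉ A
  reachable_iff : ∀ u v, (G.deleteEdges {s(p, q)}).Reachable u v ↔ (u ∈ A ↔ v ∈ A)

/-- The total length of the intervals. The power of two is a product over the instances, with factor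
1 for a message in `D` and 2 otherwise. -/
theorem sum_pow_card_filter {M : Type*} [Fintype M] [DecidableEq M] (D : Finset M) (B : ℕ) :
    ∑ m : Fin B → M, 2 ^ (Finset.univ.filter fun b => m b ∉ D).card =
      (D.card + 2 * Dᶜ.card) ^ B := by
  have h : D.card + 2 * Dᶜ.card = ∑ a : M, if a ∉ D then 2 else 1 := by
    rw [Finset.sum_ite]
    simp [Finset.filter_not, Finset.compl_eq_univ_sdiff, mul_comm, add_comm]
  rw [h, Fintype.sum_pow]
  refine Finset.sum_congr rfl fun m _ => ?_
  rw [Finset.prod_ite]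
  simp

/-- A function is computed with `L` bits on an edge if one side can send, at each instance, a
message such that the other side can compute the value from the message, and no answer is needed
for the messages in `D`. -/
theorem exists_strategy {V : Type*} [Fintype V] [DecidableEq V] {G : SimpleGraph V} {l : V → ℕ}
    {p q : V} {A : Finset V} (hA : IsCut G p q A) (f : ((v : V) → Fin (l v + 1)) → Bool)
    {M : Type*} [Fintype M] [DecidableEq M] (m : ((v : V) → Fin (l v + 1)) → M) (D : Finset M)
    (hm : ∀ x x', (∀ v ∈ A, x v = x' v) → m x = m x')
    (hf : ∀ x x', m x = m x' → (∀ v ∉ A, x v = x' v) → f x = f x')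
    (hD : ∀ x x', m x = m x' → m x ∈ D → f x = f x')
    {B L : ℕ} (hL : (D.card + 2 * Dᶜ.card) ^ B ≤ 2 ^ L) :
    ∃ S : Strategy G l B, S.Computes f ∧ ∀ x, S.bitsOn x ⟨s(p, q), hA.adj⟩ = L := by
  set e : G.edgeSet := ⟨s(p, q), hA.adj⟩ with he
  have hp : p ∈ (e : Sym2 V) := Sym2.mem_mk_left p q
  have hq : q ∈ (e : Sym2 V) := Sym2.mem_mk_right p q
  let k : (Fin B → M) → ℕ := fun μ => (Finset.univ.filter fun b => μ b ∉ D).card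
  obtain ⟨d, hdL, hd⟩ := exists_dyadic_intervals k (L := L) (by
    rw [sum_pow_card_filter]; exact hL)
  obtain ⟨S₁, hr1, hk1⟩ := Strategy.exists_flood e (Strategy.silent G l B)
  have know : ∀ u v, (G.deleteEdges {s(p, q)}).Reachable u v → S₁.Knows v (fun x => x u) := by
    intro u v huv x x' h1 h2
    funext b
    -- Flooding concerns Boolean functions only; the indicators of single values recover the
    -- measurement.
    have := hk1 u v huv (fun y => decide (y u b = x u b))
      (fun y y' hy _ => by simp only [hy]) x x' h1 h2
    simpa [eq_comm] using this
  have hpA : ∀ x x', x p = x' p → S₁.finalView x p = S₁.finalView x' p →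
      ∀ v ∈ A, x v = x' v := fun x x' h1 h2 v hv =>
    know v p ((hA.reachable_iff v p).2 (by simp [hv, hA.left_mem])) x x' h1 h2
  have hqA : ∀ x x', x q = x' q → S₁.finalView x q = S₁.finalView x' q →
      ∀ v ∉ A, x v = x' v := fun x x' h1 h2 v hv =>
    know v q ((hA.reachable_iff v q).2 (by simp [hv, hA.right_notMem])) x x' h1 h2
  let μ : BlockInput l B → Fin B → M := fun x b => m (fun v => x v b)
  let ans : BlockInput l B → Fin B → Bool := fun x b => f (fun v => x v b)
  have hcard : ∀ a : Fin B → M, Fintype.card ({b // a b ∉ D} → Bool) = 2 ^ k a := by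
    intro a
    simp [k, Fintype.card_subtype]
  -- The position inside the interval numbers the possible answers at the open instances.
  let enc : (a : Fin B → M) → (Fin B → Bool) → ℕ := fun a g =>
    (Fintype.equivFin ({b // a b ∉ D} → Bool) fun b => g b.1).1
  have henc : ∀ a g, enc a g < 2 ^ k a := fun a g => (hcard a) ▸ Fin.isLt _
  let n : BlockInput l B → ℕ := fun x => 2 ^ k (μ x) * d (μ x) + enc (μ x) (ans x)
  have hn : ∀ x, n x / 2 ^ k (μ x) = d (μ x) := by
    intro x
    rw [Nat.mul_add_div (by positivity), Nat.div_eq_of_lt (henc _ _), add_zero]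
  have hnL : ∀ x, n x < 2 ^ L := fun x =>
    lt_of_lt_of_le (Nat.add_lt_add_left (henc _ _) _) (hdL (μ x))
  have hnans : ∀ x x', n x = n x' → ans x = ans x' := by
    intro x x' h
    have hμ : μ x = μ x' := hd (n x) _ _ (hn x) (h ▸ hn x')
    have h1 : enc (μ x) (ans x) = enc (μ x) (ans x') := by
      simp only [n, ← hμ] at h
      exact Nat.add_left_cancel h
    have h2 := (Fintype.equivFin _).injective (Fin.ext h1)
    funext b
    by_cases hb : μ x b ∈ D
    · exact hD _ _ (congrFun hμ b) hb
    · exact congrFun h2 ⟨b, hb⟩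
  obtain ⟨S₂, hr2, h2⟩ := Strategy.exists_transmit hp hq
    (fun x => (hr1.2 x).trans (Strategy.reduceOption_finalHistory_silent x e)) k d hd μ n hn L hnL
    (fun x x' h1 h2 => funext fun b => hm _ _ fun v hv => by rw [hpA x x' h1 h2 v hv])
    (fun x x' h1 h2 hμ => by
      have : ans x = ans x' := funext fun b => hf _ _ (congrFun hμ b) fun v hv => by
        rw [hqA x x' h1 h2 v hv]
      simp only [n, hμ, this])
    L 0 rfl
  -- With `ρ = 0` the transcript is the full number, which determines the answers at both ends.
  have hend : ∀ w ∈ (e : Sym2 V), ∀ b, S₂.Knows w (fun x => f (fun u => x u b)) := by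
    intro w hw b x x' _ hv
    have h := (h2 x).2
    rw [Strategy.finalHistory_eq_of_finalView_eq hv e hw, (h2 x').2, pow_zero, Nat.div_one,
      Nat.div_one] at h
    exact (congrFun (hnans _ _ h) b).symm
  obtain ⟨S₃, hr3, hk3⟩ := Strategy.exists_flood e S₂
  obtain ⟨S₄, h4, hb4⟩ := Strategy.exists_computes (S := S₃) (f := f) (by
    intro v b
    by_cases hv : v ∈ A
    · exact hk3 p v ((hA.reachable_iff p v).2 (by simp [hv, hA.left_mem])) _ (hend p hp b)
    · exact hk3 q v ((hA.reachable_iff q v).2 (by simp [hv, hA.right_notMem])) _ (hend q hq b))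
  refine ⟨S₄, h4, fun x => ?_⟩
  rw [hb4, Strategy.bitsOn_eq_length_reduceOption, hr3.2, (h2 x).1]

end TreeComputation

/-! ### Lower bound: mixing inputs and fooling sets -/

namespace TreeComputation

namespace Strategy

variable {V : Type*} {G : SimpleGraph V} {l : V → ℕ} {B : ℕ}

theorem history_eq_of_le (S : Strategy G l B) {x x' : BlockInput l B} {e : G.edgeSet} {t : ℕ}
    (h : S.history x t e = S.history x' t e) {s : ℕ} (hs : s ≤ t) :
    S.history x s e = S.history x' s e := by
  induction t with
  | zero => rwa [Nat.le_zero.1 hs]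
  | succ t ih =>
    rcases Nat.le_succ_iff.1 hs with hs | rfl
    · exact ih (List.cons.inj h).2 hs
    · exact h

/-- The bits exchanged on an edge determine the history of the edge, and no such sequence of bits
is a proper initial part of another one. -/
theorem history_eq_of_suffix (S : Strategy G l B) {x x' : BlockInput l B} {e : G.edgeSet}
    {w : List Bool} (t : ℕ) (h : (S.history x t e).reduceOption <:+ w)
    (h' : (S.history x' t e).reduceOption <:+ w) : S.history x t e = S.history x' t e := by
  induction t with
  | zero => rfl
  | succ t ih =>
    have tail : ∀ (a : Option Bool) (r : EdgeHistory), r.reduceOption <:+ (a :: r).reduceOption := by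
      intro a r
      cases a with
      | none => rw [List.reduceOption_cons_of_none]
      | some b => rw [List.reduceOption_cons_of_some]; exact List.suffix_cons _ _
    have ih := ih ((tail _ _).trans h) ((tail _ _).trans h')
    simp only [history] at h h' ⊢
    rw [ih] at h ⊢
    cases hturn : S.turn e (S.history x' t e) with
    | none => rfl
    | some v =>
      rw [hturn, Option.map_some, List.reduceOption_cons_of_some] at h h'
      -- Histories are newest first, so suffixes are initial parts in time. By induction the pasts
      -- agree, so both bit lists have the same length and coincide.
      have := (List.suffix_of_suffix_length_le h h' (by simp)).eq_of_length (by simp)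
      rw [Option.map_some, Option.map_some, (List.cons.inj this).1]

/-- Inputs with the same history on the edge of a cut can be mixed: no node notices. -/
theorem history_piecewise [DecidableEq V] (S : Strategy G l B) {p q : V} {A : Finset V}
    (hA : IsCut G p q A) {x x' : BlockInput l B}
    (h : S.finalHistory x ⟨s(p, q), hA.adj⟩ = S.finalHistory x' ⟨s(p, q), hA.adj⟩)
    (t : ℕ) (ht : t ≤ S.rounds) (v : V) (ε : G.edgeSet) (hv : v ∈ (ε : Sym2 V)) :
    S.history (A.piecewise x x') t ε = S.history (if v ∈ A then x else x') t ε := by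
  induction t generalizing v ε with
  | zero => rfl
  | succ t ih =>
    have ih := ih (by omega)
    have hview : ∀ u, (fun e' : G.incidenceSet u =>
        S.history (A.piecewise x x') t ⟨e'.1, e'.2.1⟩) =
        fun e' => S.history (if u ∈ A then x else x') t ⟨e'.1, e'.2.1⟩ := fun u =>
      funext fun e' => ih u ⟨e'.1, e'.2.1⟩ e'.2.2
    have hinput : ∀ u, A.piecewise x x' u = (if u ∈ A then x else x') u := fun u => by
      by_cases hu : u ∈ A <;> simp [hu]
    -- A new entry depends on the speaker's data alone, so the mixed run follows the input of the
    -- speaker's side.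
    have step : ∀ u ∈ (ε : Sym2 V),
        S.turn ε (S.history (A.piecewise x x') t ε) = none ∨
        (∃ hu, S.turn ε (S.history (A.piecewise x x') t ε) = some ⟨u, hu⟩) →
        S.history (A.piecewise x x') (t + 1) ε = S.history (if u ∈ A then x else x') (t + 1) ε := by
      intro u hu hcase
      have h1 := ih u ε hu
      simp only [history]
      rw [h1] at hcase ⊢
      rcases hcase with hn | ⟨hu', hs⟩
      · rw [hn]; rfl
      · rw [hs, Option.map_some, Option.map_some, hview, hinput]
    cases hturn : S.turn ε (S.history (A.piecewise x x') t ε) with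
    | none => exact step v hv (Or.inl hturn)
    | some u =>
      rw [step u.1 u.2 (Or.inr ⟨u.2, hturn⟩)]
      by_cases hside : u.1 ∈ A ↔ v ∈ A
      · simp only [hside]
      -- Speaker and `v` lie on different sides, which only the cut edge joins; there the two runs
      -- agree at all times.
      · have hε : ε = ⟨s(p, q), hA.adj⟩ := by
          by_contra hne
          have huv : u.1 ≠ v := fun huv => hside (by rw [huv])
          have hs : (ε : Sym2 V) = s(u.1, v) := (Sym2.mem_and_mem_iff huv).1 ⟨u.2, hv⟩
          have hadj : G.Adj u.1 v := by
            have := ε.2; rwa [hs, SimpleGraph.mem_edgeSet] at this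
          refine hside ((hA.reachable_iff _ _).1 (SimpleGraph.Adj.reachable ?_))
          rw [SimpleGraph.deleteEdges_adj]
          exact ⟨hadj, fun hmem => hne (Subtype.ext (hs.trans hmem))⟩
        subst hε
        have := S.history_eq_of_le h ht
        split_ifs <;> simp [this]

theorem finalView_piecewise [DecidableEq V] (S : Strategy G l B) {p q : V} {A : Finset V}
    (hA : IsCut G p q A) {x x' : BlockInput l B}
    (h : S.finalHistory x ⟨s(p, q), hA.adj⟩ = S.finalHistory x' ⟨s(p, q), hA.adj⟩) (v : V) :
    S.finalView (A.piecewise x x') v = S.finalView (if v ∈ A then x else x') v :=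
  funext fun e => S.history_piecewise hA h _ le_rfl v ⟨e.1, e.2.1⟩ e.2.2

/-- The rectangle property of the histories of the edge of a cut. -/
theorem Computes.apply_piecewise [DecidableEq V] {S : Strategy G l B}
    {f : ((v : V) → Fin (l v + 1)) → Bool} (hS : S.Computes f) {p q : V} {A : Finset V}
    (hA : IsCut G p q A) {x x' : BlockInput l B}
    (h : S.finalHistory x ⟨s(p, q), hA.adj⟩ = S.finalHistory x' ⟨s(p, q), hA.adj⟩) (b : Fin B) :
    f (fun u => A.piecewise x x' u b) = f (fun u => x u b) ∧
      f (fun u => A.piecewise x x' u b) = f (fun u => x' u b) := by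
  have hp := hS (A.piecewise x x') p
  have hq := hS (A.piecewise x x') q
  rw [S.finalView_piecewise hA h, Finset.piecewise_eq_of_mem _ _ _ hA.left_mem,
    if_pos hA.left_mem, hS x p] at hp
  rw [S.finalView_piecewise hA h, Finset.piecewise_eq_of_notMem _ _ _ hA.right_notMem,
    if_neg hA.right_notMem, hS x' q] at hq
  exact ⟨(congrFun hp b).symm, (congrFun hq b).symm⟩

/-- The fooling set bound on the number of bits exchanged on the edge of a cut. -/
theorem Computes.pow_le_two_pow_worstCaseBits [Fintype V] [DecidableEq V] {S : Strategy G l B}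
    {f : ((v : V) → Fin (l v + 1)) → Bool} (hS : S.Computes f) {p q : V} {A : Finset V}
    (hA : IsCut G p q A) {N : ℕ} (X : Fin N → (v : V) → Fin (l v + 1))
    (hX : ∀ k k', f (A.piecewise (X k) (X k')) = f (X k) → f (A.piecewise (X k') (X k)) = f (X k) →
      f (X k) = f (X k') → k = k') :
    N ^ B ≤ 2 ^ S.worstCaseBits ⟨s(p, q), hA.adj⟩ := by
  set e : G.edgeSet := ⟨s(p, q), hA.adj⟩
  set c := S.worstCaseBits e
  let Y : (Fin B → Fin N) → BlockInput l B := fun κ v b => X (κ b) v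
  let bits : (Fin B → Fin N) → List Bool := fun κ => (S.finalHistory (Y κ) e).reduceOption
  have hlen : ∀ κ, (bits κ).length ≤ c := fun κ => by
    rw [← S.bitsOn_eq_length_reduceOption]
    exact Finset.le_sup (f := fun x => S.bitsOn x e) (Finset.mem_univ (Y κ))
  -- Padding to the common length `c` keeps prefix-free transcripts distinct. The padding stands in
  -- front because the latest bits do.
  let code : (Fin B → Fin N) → List.Vector Bool c := fun κ =>
    ⟨List.replicate (c - (bits κ).length) false ++ bits κ, by simp [hlen κ]⟩
  have hcode : Function.Injective code := by
    intro κ κ' h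
    have hsuf : bits κ' <:+ List.replicate (c - (bits κ).length) false ++ bits κ := by
      rw [show List.replicate (c - (bits κ).length) false ++ bits κ = _ from
        congrArg Subtype.val h]
      exact List.suffix_append _ _
    have hh : S.finalHistory (Y κ) e = S.finalHistory (Y κ') e :=
      S.history_eq_of_suffix _ (List.suffix_append _ _) hsuf
    funext b
    have h1 := hS.apply_piecewise hA hh b
    have h2 := hS.apply_piecewise hA hh.symm b
    have hpw : ∀ κ κ' : Fin B → Fin N, (fun u => A.piecewise (Y κ) (Y κ') u b) =
        A.piecewise (X (κ b)) (X (κ' b)) := by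
      intro κ κ'
      funext u
      by_cases hu : u ∈ A <;> simp [hu, Y]
    rw [hpw] at h1 h2
    exact hX _ _ h1.1 h2.2 (h1.1.symm.trans h1.2)
  have := Fintype.card_le_of_injective code hcode
  simpa [card_vector] using this

end Strategy

/-! ### Tree edges as cuts -/

theorem IsCut.symm {V : Type*} [Fintype V] [DecidableEq V] {G : SimpleGraph V} {p q : V}
    {A : Finset V} (hA : IsCut G p q A) : IsCut G q p Aᶜ where
  adj := hA.adj.symm
  left_mem := by simpa using hA.right_notMem
  right_notMem := by simpa using hA.left_mem
  reachable_iff u v := by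
    rw [Sym2.eq_swap, hA.reachable_iff, Finset.mem_compl, Finset.mem_compl, not_iff_not]

/-- An edge of a tree is a bridge, so its ends are separated. Following a walk from `i` shows that
every vertex stays connected to `i` or `j`. -/
theorem isCut_edgeSide {V : Type*} [Fintype V] {G : SimpleGraph V} (hG : G.IsTree) {i j : V}
    (hij : G.Adj i j) : IsCut G i j (edgeSide G i j) := by
  have hmem : ∀ v, v ∈ edgeSide G i j ↔ (G.deleteEdges {s(i, j)}).Reachable i v := by
    simp [edgeSide]
  have hnot : ¬ (G.deleteEdges {s(i, j)}).Reachable i j :=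
    SimpleGraph.isBridge_iff.1
      (SimpleGraph.isAcyclic_iff_forall_adj_isBridge.1 hG.isAcyclic hij)
  have hor : ∀ v, (G.deleteEdges {s(i, j)}).Reachable i v ∨
      (G.deleteEdges {s(i, j)}).Reachable j v := by
    intro v
    have hv := hG.connected.preconnected i v
    rw [SimpleGraph.reachable_iff_reflTransGen] at hv
    induction hv with
    | refl => exact Or.inl (SimpleGraph.Reachable.refl _)
    | @tail u w _ huw ih =>
      by_cases he : s(u, w) = s(i, j)
      · rcases Sym2.eq_iff.1 he with ⟨-, rfl⟩ | ⟨-, rfl⟩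
        · exact Or.inr (SimpleGraph.Reachable.refl _)
        · exact Or.inl (SimpleGraph.Reachable.refl _)
      · have hadj : (G.deleteEdges {s(i, j)}).Adj u w := by
          rw [SimpleGraph.deleteEdges_adj]; exact ⟨huw, he⟩
        exact ih.imp (·.trans hadj.reachable) (·.trans hadj.reachable)
  refine ⟨hij, (hmem i).2 (SimpleGraph.Reachable.refl _), fun h => hnot ((hmem j).1 h),
    fun u v => ?_⟩
  rw [hmem, hmem]
  refine ⟨fun h => ⟨(·.trans h), (·.trans h.symm)⟩, fun h => ?_⟩
  by_cases hu : (G.deleteEdges {s(i, j)}).Reachable i u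
  · exact hu.symm.trans (h.1 hu)
  · exact ((hor u).resolve_left hu).symm.trans ((hor v).resolve_left fun hv => hu (h.2 hv))

theorem sum_le_totalSize {V : Type*} {l : V → ℕ} (A : Finset V) (x : (v : V) → Fin (l v + 1)) :
    ∑ v ∈ A, (x v : ℕ) ≤ totalSize l A :=
  Finset.sum_le_sum fun v _ => Nat.lt_succ_iff.1 (x v).2

theorem exists_sum_eq {V : Type*} (l : V → ℕ) (A : Finset V) {a : ℕ} (ha : a ≤ totalSize l A) :
    ∃ y : (v : V) → Fin (l v + 1), ∑ v ∈ A, (y v : ℕ) = a := by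
  classical
  induction A using Finset.induction_on generalizing a with
  | empty => exact ⟨fun _ => 0, by simpa [totalSize, eq_comm] using ha⟩
  | insert v A hv ih =>
    rw [totalSize, Finset.sum_insert hv, ← totalSize] at ha
    obtain ⟨y, hy⟩ := ih (a := a - min a (l v)) (by omega)
    refine ⟨Function.update y v ⟨min a (l v), by omega⟩, ?_⟩
    rw [Finset.sum_insert hv, Function.update_self]
    rw [Finset.sum_congr rfl fun u hu =>
      by rw [Function.update_of_ne (fun h : u = v => hv (h ▸ hu))], hy]
    exact Nat.add_sub_cancel' (min_le_left _ _)

/-! ### Bounds for the sum-threshold function -/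

/-- The size of a largest fooling set for the sum-threshold function. -/
def thresholdSize (θ a b : ℕ) : ℕ :=
  min (2 * θ + 1) (min (2 * min a b + 2) (2 * (a + b + 1 - θ) + 1))

/-- The pairs form a staircase on which the total alternates between `θ` and `θ - 1`. For two
distinct pairs with the same total, one mixture has a larger total and the other a smaller one, so
some mixture crosses the threshold. Pairs with different totals already differ in value. -/
theorem exists_fooling_pairs {θ a b : ℕ} (hθ : θ ≤ a + b + 1) :
    ∃ s t : Fin (thresholdSize θ a b) → ℕ, (∀ k, s k ≤ a ∧ t k ≤ b) ∧
      ∀ k k', (θ ≤ s k + t k' ↔ θ ≤ s k + t k) → (θ ≤ s k' + t k ↔ θ ≤ s k + t k) →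
        (θ ≤ s k + t k ↔ θ ≤ s k' + t k') → k = k' := by
  by_cases h1 : a + b + 1 - θ ≤ min a b
  -- For large `θ` the staircase starts at the maximal `s = a`, with total `θ - 1`; here `θ > a`, so
  -- no subtraction truncates.
  · refine ⟨fun k => a - k / 2, fun k => θ + (k + 1) / 2 - 1 - a, fun k => ?_,
      fun k k' h2 h3 h4 => ?_⟩
    · have := k.2; unfold thresholdSize at this; simp only; omega
    · have := k.2; have := k'.2; unfold thresholdSize at *; apply Fin.ext; simp only at *; omega
  · by_cases h2 : a ≤ b
    -- Now `θ ≤ max a b`: the staircase starts with 0 on the side of smaller capacity and `θ` on the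
    -- other.
    · refine ⟨fun k => k / 2, fun k => θ - (k + 1) / 2, fun k => ?_, fun k k' h2 h3 h4 => ?_⟩
      · have := k.2; unfold thresholdSize at this; simp only; omega
      · have := k.2; have := k'.2; unfold thresholdSize at *; apply Fin.ext; simp only at *; omega
    · refine ⟨fun k => θ - (k + 1) / 2, fun k => k / 2, fun k => ?_, fun k k' h2 h3 h4 => ?_⟩
      · have := k.2; unfold thresholdSize at this; simp only; omega
      · have := k.2; have := k'.2; unfold thresholdSize at *; apply Fin.ext; simp only at *; omega

section SumThreshold

variable {V : Type*} [Fintype V] [DecidableEq V] {G : SimpleGraph V} {l : V → ℕ} {p q : V}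
  {A : Finset V}

theorem sumThreshold_eq (l : V → ℕ) (θ : ℕ) (A : Finset V) (x : (v : V) → Fin (l v + 1)) :
    sumThreshold l θ x = decide (θ ≤ ∑ v ∈ A, (x v : ℕ) + ∑ v ∈ Aᶜ, (x v : ℕ)) := by
  rw [Finset.sum_add_sum_compl, sumThreshold]

theorem totalSize_add_totalSize_compl (l : V → ℕ) (A : Finset V) :
    totalSize l A + totalSize l Aᶜ = totalSize l Finset.univ :=
  Finset.sum_add_sum_compl A l

theorem clog_le_worstCaseBits (hA : IsCut G p q A) {θ : ℕ}
    (hθ : θ ≤ totalSize l Finset.univ + 1) {B : ℕ} {S : Strategy G l B}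
    (hS : S.Computes (sumThreshold l θ)) :
    Nat.clog 2 (thresholdSize θ (totalSize l A) (totalSize l Aᶜ) ^ B) ≤
      S.worstCaseBits ⟨s(p, q), hA.adj⟩ := by
  rw [← totalSize_add_totalSize_compl l A] at hθ
  obtain ⟨s, t, hst, hfool⟩ := exists_fooling_pairs hθ
  choose y hy using fun k => exists_sum_eq l A (hst k).1
  choose z hz using fun k => exists_sum_eq l Aᶜ (hst k).2
  have hmix : ∀ x x' : (v : V) → Fin (l v + 1), sumThreshold l θ (A.piecewise x x') =
      decide (θ ≤ ∑ v ∈ A, (x v : ℕ) + ∑ v ∈ Aᶜ, (x' v : ℕ)) := by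
    intro x x'
    rw [sumThreshold_eq l θ A]
    congr 3
    · exact Finset.sum_congr rfl fun v hv => by simp [hv]
    · exact Finset.sum_congr rfl fun v hv => by simp [Finset.mem_compl.1 hv]
  refine Nat.clog_le_of_le_pow
    (hS.pow_le_two_pow_worstCaseBits hA (fun k => A.piecewise (y k) (z k)) fun k k' => ?_)
  have hpw : ∀ k k', A.piecewise (A.piecewise (y k) (z k)) (A.piecewise (y k') (z k')) =
      A.piecewise (y k) (z k') := by
    intro k k'
    funext v
    by_cases hv : v ∈ A <;> simp [hv]
  simp only [hpw, hmix, hy, hz, decide_eq_decide]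
  exact hfool k k'

/-- The side sum is sent capped at `θ`. The cap alone settles the value, as 1, so `θ` messages need
an answer and one does not. -/
theorem exists_strategy_of_pow_le {θ B L : ℕ} (hA : IsCut G p q A)
    (hL : (2 * θ + 1) ^ B ≤ 2 ^ L) :
    ∃ S : Strategy G l B, S.Computes (sumThreshold l θ) ∧
      ∀ x, S.bitsOn x ⟨s(p, q), hA.adj⟩ = L := by
  refine exists_strategy hA _
    (fun x => (⟨min (∑ v ∈ A, (x v : ℕ)) θ, by omega⟩ : Fin (θ + 1))) {Fin.last θ}
    (fun x x' h => ?_) (fun x x' h h' => ?_) (fun x x' h h' => ?_) ?_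
  · simp only [Finset.sum_congr rfl fun v hv => congrArg Fin.val (h v hv)]
  · rw [sumThreshold_eq l θ A, sumThreshold_eq l θ A, decide_eq_decide,
      Finset.sum_congr (s₁ := Aᶜ) rfl fun v hv => congrArg Fin.val (h' v (Finset.mem_compl.1 hv))]
    simp only [Fin.mk.injEq] at h
    omega
  · rw [sumThreshold_eq l θ A, sumThreshold_eq l θ A, decide_eq_decide]
    simp only [Finset.mem_singleton, Fin.ext_iff, Fin.val_last] at h h'
    omega
  · rw [Finset.card_compl]
    simpa [add_comm] using hL

/-- The dual protocol sends the deficit from the maximal side sum. Once it reaches the cap, the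
total is below `θ` whatever the other side holds. -/
theorem exists_strategy_of_pow_le_of_large {θ B L : ℕ} (hA : IsCut G p q A)
    (hθ : θ ≤ totalSize l Finset.univ + 1)
    (hL : (2 * (totalSize l Finset.univ + 1 - θ) + 1) ^ B ≤ 2 ^ L) :
    ∃ S : Strategy G l B, S.Computes (sumThreshold l θ) ∧
      ∀ x, S.bitsOn x ⟨s(p, q), hA.adj⟩ = L := by
  have hsum := totalSize_add_totalSize_compl l A
  have hle : ∀ x : (v : V) → Fin (l v + 1), ∑ v ∈ A, (x v : ℕ) ≤ totalSize l A :=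
    sum_le_totalSize A
  have hle' : ∀ x : (v : V) → Fin (l v + 1), ∑ v ∈ Aᶜ, (x v : ℕ) ≤ totalSize l Aᶜ :=
    sum_le_totalSize Aᶜ
  refine exists_strategy hA _
    (fun x => (⟨min (totalSize l A - ∑ v ∈ A, (x v : ℕ)) (totalSize l Finset.univ + 1 - θ),
      by omega⟩ : Fin (totalSize l Finset.univ + 1 - θ + 1))) {Fin.last _}
    (fun x x' h => ?_) (fun x x' h h' => ?_) (fun x x' h h' => ?_) ?_
  · simp only [Finset.sum_congr rfl fun v hv => congrArg Fin.val (h v hv)]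
  · have h1 := hle x
    have h2 := hle x'
    have h3 := hle' x'
    rw [sumThreshold_eq l θ A, sumThreshold_eq l θ A, decide_eq_decide,
      Finset.sum_congr (s₁ := Aᶜ) rfl fun v hv => congrArg Fin.val (h' v (Finset.mem_compl.1 hv))]
    simp only [Fin.mk.injEq] at h
    omega
  · have h1 := hle x
    have h2 := hle x'
    have h3 := hle' x
    have h4 := hle' x'
    rw [sumThreshold_eq l θ A, sumThreshold_eq l θ A, decide_eq_decide]
    simp only [Finset.mem_singleton, Fin.ext_iff, Fin.val_last] at h h'
    omega
  · rw [Finset.card_compl]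
    simpa [add_comm] using hL

/-- The exact side sum is sent and every message is answered, so `D` is empty. -/
theorem exists_strategy_of_pow_le_side {θ B L : ℕ} (hA : IsCut G p q A)
    (hL : (2 * totalSize l A + 2) ^ B ≤ 2 ^ L) :
    ∃ S : Strategy G l B, S.Computes (sumThreshold l θ) ∧
      ∀ x, S.bitsOn x ⟨s(p, q), hA.adj⟩ = L := by
  refine exists_strategy hA _
    (fun x => (⟨∑ v ∈ A, (x v : ℕ), Nat.lt_succ_of_le (sum_le_totalSize A x)⟩ :
      Fin (totalSize l A + 1))) ∅
    (fun x x' h => ?_) (fun x x' h h' => ?_) (fun x x' h h' => ?_) ?_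
  · simp only [Finset.sum_congr rfl fun v hv => congrArg Fin.val (h v hv)]
  · rw [sumThreshold_eq l θ A, sumThreshold_eq l θ A, decide_eq_decide,
      Finset.sum_congr (s₁ := Aᶜ) rfl fun v hv => congrArg Fin.val (h' v (Finset.mem_compl.1 hv))]
    simp only [Fin.mk.injEq] at h
    omega
  · simp at h'
  · simpa [mul_add] using hL

theorem exists_strategy_of_thresholdSize_pow_le {θ B L : ℕ} (hA : IsCut G p q A)
    (hθ : θ ≤ totalSize l Finset.univ + 1)
    (hL : thresholdSize θ (totalSize l A) (totalSize l Aᶜ) ^ B ≤ 2 ^ L) :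
    ∃ S : Strategy G l B, S.Computes (sumThreshold l θ) ∧
      ∀ x, S.bitsOn x ⟨s(p, q), hA.adj⟩ = L := by
  have hsum := totalSize_add_totalSize_compl l A
  have hcases : thresholdSize θ (totalSize l A) (totalSize l Aᶜ) = 2 * θ + 1 ∨
      thresholdSize θ (totalSize l A) (totalSize l Aᶜ) = 2 * totalSize l A + 2 ∨
      thresholdSize θ (totalSize l A) (totalSize l Aᶜ) = 2 * totalSize l Aᶜ + 2 ∨
      thresholdSize θ (totalSize l A) (totalSize l Aᶜ) =
        2 * (totalSize l Finset.univ + 1 - θ) + 1 := by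
    unfold thresholdSize; omega
  rcases hcases with h | h | h | h <;> rw [h] at hL
  · exact exists_strategy_of_pow_le hA hL
  · exact exists_strategy_of_pow_le_side hA hL
  · obtain ⟨S, h1, h2⟩ := exists_strategy_of_pow_le_side (θ := θ) hA.symm hL
    refine ⟨S, h1, fun x => ?_⟩
    rw [← h2 x]
    congr 2
    exact Sym2.eq_swap
  · exact exists_strategy_of_pow_le_of_large hA hθ hL

theorem isLeast_edgeCosts_sumThreshold (hA : IsCut G p q A) {θ : ℕ}
    (hθ : θ ≤ totalSize l Finset.univ + 1) (B : ℕ) :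
    IsLeast (edgeCosts G l (sumThreshold l θ) ⟨s(p, q), hA.adj⟩ B)
      (Nat.clog 2 (thresholdSize θ (totalSize l A) (totalSize l Aᶜ) ^ B)) := by
  constructor
  · obtain ⟨S, h1, h2⟩ := exists_strategy_of_thresholdSize_pow_le (B := B) hA hθ
      (Nat.le_pow_clog one_lt_two _)
    refine ⟨S, h1, ?_⟩
    simp only [Strategy.worstCaseBits, h2]
    exact Finset.sup_const ⟨fun _ _ => 0, Finset.mem_univ _⟩ _
  · rintro c ⟨S, hS, rfl⟩
    exact clog_le_worstCaseBits hA hθ hS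

end SumThreshold

/-! ### The limit and the main theorem -/

/-- The numerator is the ceiling of `B * Real.logb 2 N`, and rounding up is negligible after
division by `B`. -/
theorem tendsto_clog_pow_div {N : ℕ} (hN : 0 < N) :
    Filter.Tendsto (fun B : ℕ => (Nat.clog 2 (N ^ B) : ℝ) / (B : ℝ)) Filter.atTop
      (nhds (Real.logb 2 N)) := by
  have hlog : 0 ≤ Real.logb 2 N := Real.logb_nonneg one_lt_two (by exact_mod_cast hN)
  have h := (tendsto_nat_ceil_mul_div_atTop hlog).comp (tendsto_natCast_atTop_atTop (R := ℝ))
  refine h.congr fun B => ?_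
  have := Real.natCeil_logb_natCast 2 (N ^ B)
  push_cast at this
  rw [Real.logb_pow] at this
  rw [Function.comp_apply, mul_comm, this]

end TreeComputation

theorem mainTheorem5 {V : Type*} [Fintype V] [DecidableEq V] (G : SimpleGraph V) (hG : G.IsTree)
    (l : V → ℕ) (θ : ℕ) (hθ : θ ≤ TreeComputation.totalSize l Finset.univ + 1)
    (i j : V) (hij : G.Adj i j) :
    TreeComputation.HasEdgeComplexity G l (TreeComputation.sumThreshold l θ) ⟨s(i, j), hij⟩
      (Real.logb 2
        (min (2 * (θ : ℝ) + 1)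
          (min
            (2 * min (TreeComputation.totalSize l (TreeComputation.edgeSide G i j) : ℝ)
                (TreeComputation.totalSize l (TreeComputation.edgeSide G i j)ᶜ : ℝ) + 2)
            (2 * ((TreeComputation.totalSize l Finset.univ : ℝ) - (θ : ℝ) + 1) + 1)))) := by
  refine ⟨_, TreeComputation.isLeast_edgeCosts_sumThreshold
    (TreeComputation.isCut_edgeSide hG hij) hθ, ?_⟩
  convert TreeComputation.tendsto_clog_pow_div
    (N := TreeComputation.thresholdSize θ
      (TreeComputation.totalSize l (TreeComputation.edgeSide G i j))
      (TreeComputation.totalSize l (TreeComputation.edgeSide G i j)ᶜ))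
    (by unfold TreeComputation.thresholdSize; omega) using 3
  unfold TreeComputation.thresholdSize
  rw [TreeComputation.totalSize_add_totalSize_compl]
  -- By `hθ` the natural subtraction in `thresholdSize` agrees with the real one.
  push_cast [Nat.cast_sub hθ]
  congr 3
  ring
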